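/- **Conventions.** A *tuple* over a finite set $S$ of attributes maps each $A\in S$ to a value in its domain $\mathrm{dom}(A)$; a *relation* over $S$ is a finite set of tuples over $S$, and $\pi_B R$ is the projection of $R$ onto $B\subseteq S$. A *natural join query* is $Q=R_1(S_1)\Join\dots\Join R_n(S_n)$ with pairwise distinct relation symbols $R_i$ over finite attribute sets $S_i$; $\mathrm{att}(Q)=\bigcup_i S_i$. A *database* $D$ for $Q$ gives for each $R_i$ a relation over $S_i$, also denoted $R_i$; $|D|=\sum_i|R_i|$. The result $Q(D)$ is the set of all tuples $t$ over $\mathrm{att}(Q)$ with $\pi_{S_i}t\in R_i$ for all $i$. The hypergraph $H$ of $Q$ is the multi-hypergraph with node set $\mathrm{att}(Q)$ and one edge $S_i$ for each $i\in\{1,\dots,n\}$. A *(fractional hypertree) decomposition* of $Q$ is $\mathcal T=(T,\chi,\{\gamma_t\}_{t\in T})$, where $T$ is a finite tree, $\chi$ maps each node $t$ of $T$ to a *bag* $\chi(t)\subseteq\mathrm{att}(Q)$ such that every $S_i$ is contained in some bag and, for each $A\in\mathrm{att}(Q)$, the set $\{t: A\in\chi(t)\}$ is non-empty and induces a connected subtree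 of $T$; and $\gamma_t$ is a fractional edge cover of minimal weight of $H$ restricted to $\chi(t)$, that is, a function $\gamma_t:\{1,\dots,n\}\to[0,\infty)$ with $\sum_{i:\,A\in S_i}\gamma_t(i)\ge 1$ for all $A\in\chi(t)$ whose weight $\sum_i\gamma_t(i)$ is the least among such functions. Its *width* is $\mathrm{fhtw}(\mathcal T)=\max_{t\in T}\sum_i\gamma_t(i)$. A relation $K$ over $\mathrm{att}(Q)$ is *result-preserving* with respect to $(Q,\mathcal T,D)$ if $\pi_BK=\pi_BQ(D)$ for every bag $B$ of $\mathcal T$. A *cover of $Q(D)$ over $\mathcal T$* is a result-preserving relation no strict subset of which is result-preserving. **Theorem.** Let $Q$ be a natural join query and $\mathcal T$ a decomposition of $Q$. (i) There is a constant $C>0$, depending only on $Q$ and $\mathcal T$, such that for every database $D$ every cover $K$ of $Q(D)$ over $\mathcal T$ satisfies $|K|\le C\,|D|^{\mathrm{fhtw}(\mathcal T)}$ (where $0^0=1$). (ii) If $Q$ has at least one attribute, then there is a constant $c>0$, depending only on $Q$ and $\mathcal T$, such that, whenever every attribute of $Q$ has an infinite domain, for every $M\in\mathbb N$ there is a database $D$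 with $|D|\ge M$ such that every cover $K$ of $Q(D)$ over $\mathcal T$ satisfies $|K|\ge c\,|D|^{\mathrm{fhtw}(\mathcal T)}$. -/

import Mathlib

universe u v w

/-- A tuple over the relation schema `S`: a mapping from the attributes in `S` to values in their
respective domains. -/
abbrev Tuple {Att : Type u} (dom : Att → Type v) (S : Finset Att) : Type (max u v) :=
  (a : S) → dom a

/-- A relation over the relation schema `S`: a finite set of tuples over `S`. -/
abbrev Relation {Att : Type u} (dom : Att → Type v) (S : Finset Att) : Type (max u v) :=
  Finset (Tuple dom S)

open Classical in
/-- The projection `π_B R` of a relation `R` over `S` onto a set `B ⊆ S` of attributes. -/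
noncomputable def Relation.proj {Att : Type u} {dom : Att → Type v} {B S : Finset Att}
    (h : B ⊆ S) (R : Relation dom S) : Relation dom B :=
  R.image (Finset.restrict₂ (π := dom) h)

/-- A multi-hypergraph on a finite set of nodes. The edges are indexed by `E`, so that distinct
edges may have the same node set. -/
structure MultiHypergraph (V : Type u) (E : Type v) where
  nodes : Finset V
  edge : E → Finset V
  edge_subset : ∀ e, edge e ⊆ nodes

namespace MultiHypergraph

variable {V : Type u} {E : Type v} [DecidableEq V]

/-- The subgraph of `H` restricted to the node set `X`: every edge is intersected with `X`. -/
def restrict (H : MultiHypergraph V E) (X : Finset V) : MultiHypergraph V E where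
  nodes := H.nodes ∩ X
  edge e := H.edge e ∩ X
  edge_subset e := Finset.inter_subset_inter_right (H.edge_subset e)

variable [Fintype E]

/-- A fractional edge cover: nonnegative edge weights such that the weights of the edges incident
to any node add up to at least `1`. -/
def IsFractionalEdgeCover (H : MultiHypergraph V E) (γ : E → ℝ) : Prop :=
  (∀ e, 0 ≤ γ e) ∧ ∀ v ∈ H.nodes, 1 ≤ ∑ e with v ∈ H.edge e, γ e

/-- A fractional edge cover of minimal weight, where the weight of `γ` is `∑ e, γ e`. -/
def IsMinFractionalEdgeCover (H : MultiHypergraph V E) (γ : E → ℝ) : Prop :=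
  H.IsFractionalEdgeCover γ ∧ ∀ γ', H.IsFractionalEdgeCover γ' → ∑ e, γ e ≤ ∑ e, γ' e

end MultiHypergraph

/-- A natural join query `R_1(S_1) ⋈ ... ⋈ R_n(S_n)` with pairwise distinct relation symbols,
the `i`-th of which has the schema `schema i`. -/
structure NaturalJoinQuery (Att : Type u) where
  n : ℕ
  schema : Fin n → Finset Att

namespace NaturalJoinQuery

variable {Att : Type u} [DecidableEq Att]

/-- The set of attributes of a query. -/
def att (Q : NaturalJoinQuery Att) : Finset Att :=
  Finset.univ.biUnion Q.schema

theorem schema_subset_att (Q : NaturalJoinQuery Att) (i : Fin Q.n) : Q.schema i ⊆ Q.att :=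
  Finset.subset_biUnion_of_mem Q.schema (Finset.mem_univ i)

/-- The hypergraph of a query: one node per attribute and one edge per relation symbol. -/
def hypergraph (Q : NaturalJoinQuery Att) : MultiHypergraph Att (Fin Q.n) where
  nodes := Q.att
  edge := Q.schema
  edge_subset := Q.schema_subset_att

end NaturalJoinQuery

/-- A database for `Q`: one relation for each relation symbol of `Q`, over the same schema. -/
abbrev Database {Att : Type u} (dom : Att → Type v) (Q : NaturalJoinQuery Att) :
    Type (max u v) :=
  (i : Fin Q.n) → Relation dom (Q.schema i)

/-- The size of a database: the sum of the sizes of its relations. -/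
def Database.size {Att : Type u} {dom : Att → Type v} {Q : NaturalJoinQuery Att}
    (D : Database dom Q) : ℕ :=
  ∑ i, (D i).card

namespace NaturalJoinQuery

variable {Att : Type u} [DecidableEq Att] {dom : Att → Type v}

theorem finite_result (Q : NaturalJoinQuery Att) (D : Database dom Q) :
    {t : Tuple dom Q.att |
      ∀ i, Finset.restrict₂ (π := dom) (Q.schema_subset_att i) t ∈ D i}.Finite := by
  refine Set.Finite.of_finite_image (f := fun (t : Tuple dom Q.att) (i : Fin Q.n) =>
    Finset.restrict₂ (π := dom) (Q.schema_subset_att i) t) ?_ ?_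
  · refine (Set.Finite.pi' fun i => (D i).finite_toSet).subset ?_
    rintro _ ⟨t, ht, rfl⟩ i
    exact ht i
  · intro s _ t _ hst
    funext a
    obtain ⟨i, -, hi⟩ := Finset.mem_biUnion.1 a.2
    exact congrFun (congrFun hst i) ⟨a, hi⟩

/-- The query result `Q(D)`: the natural join of the relations of `D`, that is, all tuples over
the attributes of `Q` whose projection onto each schema is in the corresponding relation. -/
noncomputable def result (Q : NaturalJoinQuery Att) (D : Database dom Q) : Relation dom Q.att :=
  (Q.finite_result D).toFinset

theorem mem_result (Q : NaturalJoinQuery Att) (D : Database dom Q) (t : Tuple dom Q.att) :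
    t ∈ Q.result D ↔ ∀ i, Finset.restrict₂ (π := dom) (Q.schema_subset_att i) t ∈ D i := by
  simp [result]

end NaturalJoinQuery

/-- A hypertree decomposition of (the hypergraph of) `Q`, on a tree with node type `N`. -/
structure HypertreeDecomposition {Att : Type u} [DecidableEq Att] (Q : NaturalJoinQuery Att)
    (N : Type w) where
  tree : SimpleGraph N
  isTree : tree.IsTree
  bag : N → Finset Att
  bag_subset : ∀ t, bag t ⊆ Q.att
  coverage : ∀ i, ∃ t, Q.schema i ⊆ bag t
  /-- The nodes whose bags contain a given attribute form a non-empty connected subtree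
  (`SimpleGraph.Connected` includes non-emptiness). -/
  connectivity : ∀ a ∈ Q.att, (tree.induce {t | a ∈ bag t}).Connected

/-- A fractional hypertree decomposition: each tree node `t` is equipped with a fractional edge
cover `γ t` of minimal weight for the hypergraph of `Q` restricted to the bag of `t`. -/
structure FractionalHypertreeDecomposition {Att : Type u} [DecidableEq Att]
    (Q : NaturalJoinQuery Att) (N : Type w) extends HypertreeDecomposition Q N where
  γ : N → Fin Q.n → ℝ
  γ_min : ∀ t, (Q.hypergraph.restrict (bag t)).IsMinFractionalEdgeCover (γ t)

namespace FractionalHypertreeDecomposition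

variable {Att : Type u} [DecidableEq Att] {Q : NaturalJoinQuery Att} {N : Type w}

theorem univ_nonempty [Fintype N] (T : FractionalHypertreeDecomposition Q N) :
    (Finset.univ : Finset N).Nonempty :=
  Finset.univ_nonempty_iff.2 T.isTree.connected.nonempty

/-- The fractional hypertree width of `T`: the maximal weight of the covers `γ t`. -/
noncomputable def fhtw [Fintype N] (T : FractionalHypertreeDecomposition Q N) : ℝ :=
  Finset.univ.sup' T.univ_nonempty fun t => ∑ i, T.γ t i

variable {dom : Att → Type v}

/-- A relation `K` over the attributes of `Q` is result-preserving if `π_B K = π_B Q(D)` for each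
bag `B` of `T`. -/
def ResultPreserving (T : FractionalHypertreeDecomposition Q N) (D : Database dom Q)
    (K : Relation dom Q.att) : Prop :=
  ∀ t, Relation.proj (T.bag_subset t) K = Relation.proj (T.bag_subset t) (Q.result D)

/-- A cover of `Q(D)` over `T`: a result-preserving relation no strict subset of which is
result-preserving. -/
def IsCover (T : FractionalHypertreeDecomposition Q N) (D : Database dom Q)
    (K : Relation dom Q.att) : Prop :=
  T.ResultPreserving D K ∧ ∀ K' ⊂ K, ¬ T.ResultPreserving D K'

end FractionalHypertreeDecomposition

/-! A cover is squeezed between its bag projections. By minimality it has at most as many tuples as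
all bag projections of the result together, since one representative per projected tuple already
preserves the result; and it has at least as many as any single bag projection. So everything
reduces to the size of `π_B Q(D)`.

For the upper bound, `projCard_le_prod_rpow` bounds this size by a product of relation sizes raised
to the weights of a fractional edge cover of `B`. It is proved by induction on `B`, splitting on the
values of one attribute and recombining with Hölder.

For the lower bound, LP duality (`exists_packing`) turns the minimal cover of the widest bag into a
vertex packing `y` of the same weight. Giving each attribute `a` of the bag about `m ^ y a` values
and taking full products keeps every relation below `m`, while the bag projection has about `m ^
fhtw` tuples. -/

/-- A form of Hölder's inequality: the exponents over `P` add up to at least `1`, and the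
remaining factors are bounded pointwise. -/
theorem sum_prod_rpow_le_prod_rpow {ι κ : Type*} [Fintype ι] (s : Finset κ) (P : Finset ι)
    (γ : ι → ℝ) (hγ : ∀ i, 0 ≤ γ i) (hP : 1 ≤ ∑ i ∈ P, γ i) (f : ι → κ → ℝ) (F : ι → ℝ)
    (hf : ∀ i, ∀ k ∈ s, 0 ≤ f i k) (hF : ∀ i, 0 < F i) (hfF : ∀ i, ∀ k ∈ s, f i k ≤ F i)
    (hsum : ∀ i ∈ P, ∑ k ∈ s, f i k ≤ F i) :
    ∑ k ∈ s, ∏ i, f i k ^ γ i ≤ ∏ i, F i ^ γ i := by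
  set G := ∑ i ∈ P, γ i with hG
  have hG0 : 0 < G := zero_lt_one.trans_le hP
  have hprod : 0 ≤ ∏ i, F i ^ γ i :=
    Finset.prod_nonneg fun i _ => Real.rpow_nonneg (hF i).le _
  -- The ratios `f i k / F i` lie in `[0, 1]`, so dropping factors outside `P` and shrinking
  -- exponents to `γ i / G` only increases the product. The exponents then sum to `1` and weighted
  -- AM-GM applies.
  have key : ∀ k ∈ s, ∏ i, f i k ^ γ i ≤
      (∏ i, F i ^ γ i) * ∑ i ∈ P, γ i / G * (f i k / F i) := by
    intro k hk
    have hq0 : ∀ i, 0 ≤ f i k / F i := fun i => div_nonneg (hf i k hk) (hF i).le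
    have hq1 : ∀ i, f i k / F i ≤ 1 := fun i => (div_le_one (hF i)).2 (hfF i k hk)
    have h1 : ∏ i, f i k ^ γ i = (∏ i, F i ^ γ i) * ∏ i, (f i k / F i) ^ γ i := by
      rw [← Finset.prod_mul_distrib]
      refine Finset.prod_congr rfl fun i _ => ?_
      rw [← Real.mul_rpow (hF i).le (hq0 i), mul_div_cancel₀ _ (hF i).ne']
    rw [h1]
    refine mul_le_mul_of_nonneg_left ?_ hprod
    calc ∏ i, (f i k / F i) ^ γ i ≤ ∏ i ∈ P, (f i k / F i) ^ γ i := by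
          classical
          rw [← Finset.prod_mul_prod_compl P]
          exact mul_le_of_le_one_right
            (Finset.prod_nonneg fun i _ => Real.rpow_nonneg (hq0 i) _)
            (Finset.prod_le_one (fun i _ => Real.rpow_nonneg (hq0 i) _)
              fun i _ => Real.rpow_le_one (hq0 i) (hq1 i) (hγ i))
      _ ≤ ∏ i ∈ P, (f i k / F i) ^ (γ i / G) :=
          Finset.prod_le_prod (fun i _ => Real.rpow_nonneg (hq0 i) _) fun i _ =>
            Real.rpow_le_rpow_of_exponent_ge' (hq0 i) (hq1 i) (div_nonneg (hγ i) hG0.le)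
              (div_le_self (hγ i) hP)
      _ ≤ ∑ i ∈ P, γ i / G * (f i k / F i) := by
          refine Real.geom_mean_le_arith_mean_weighted P (fun i => γ i / G) _
            (fun i _ => div_nonneg (hγ i) hG0.le) ?_ fun i _ => hq0 i
          rw [← Finset.sum_div, ← hG, div_self hG0.ne']
  refine (Finset.sum_le_sum key).trans ?_
  rw [← Finset.mul_sum, Finset.sum_comm]
  refine mul_le_of_le_one_right hprod ?_
  calc ∑ i ∈ P, ∑ k ∈ s, γ i / G * (f i k / F i)
      = ∑ i ∈ P, γ i / G * ((∑ k ∈ s, f i k) / F i) := by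
        simp only [Finset.mul_sum, Finset.sum_div]
    _ ≤ ∑ i ∈ P, γ i / G := Finset.sum_le_sum fun i hi =>
        mul_le_of_le_one_right (div_nonneg (hγ i) hG0.le) ((div_le_one (hF i)).2 (hsum i hi))
    _ = 1 := by rw [← Finset.sum_div, ← hG, div_self hG0.ne']

/-! ### Counting joint values; the fractional edge cover bound. -/

section ProjCard

variable {V : Type u} {Ω : Type w} {β : V → Type v}

open Classical in
/-- The number of distinct joint values that the coordinates `X a`, `a ∈ S`, take on `J`. -/
noncomputable def projCard (X : ∀ a, Ω → β a) (S : Finset V) (J : Finset Ω) : ℕ :=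
  (J.image fun ω (a : S) => X a ω).card

variable (X : ∀ a, Ω → β a)

open Classical in
theorem projCard_mono (S : Finset V) {J J' : Finset Ω} (h : J ⊆ J') :
    projCard X S J ≤ projCard X S J' :=
  Finset.card_le_card (Finset.image_subset_image h)

open Classical in
theorem projCard_pos (S : Finset V) {J : Finset Ω} (h : J.Nonempty) : 0 < projCard X S J :=
  Finset.card_pos.2 (h.image _)

theorem projCard_empty_le_one (J : Finset Ω) : projCard X ∅ J ≤ 1 := by
  refine Finset.card_le_one.2 fun x _ y _ => ?_
  funext a
  exact absurd a.2 (Finset.notMem_empty _)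

open Classical in
theorem projCard_eq_sum_fiber {S : Finset V} {a : V} (ha : a ∈ S) (J : Finset Ω) :
    projCard X S J = ∑ v ∈ J.image (X a), projCard X S (J.filter fun ω => X a ω = v) := by
  unfold projCard
  rw [Finset.card_eq_sum_card_fiberwise (f := fun p : (b : S) → β b => p ⟨a, ha⟩)
    (t := J.image (X a))]
  · refine Finset.sum_congr rfl fun v _ => ?_
    rw [Finset.filter_image]
  · intro p hp
    obtain ⟨ω, hω, rfl⟩ := Finset.mem_image.1 (Finset.mem_coe.1 hp)
    exact Finset.mem_coe.2 (Finset.mem_image_of_mem _ hω)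

open Classical in
theorem projCard_insert_fiber (B : Finset V) (a : V) (v : β a) (J : Finset Ω) :
    projCard X (insert a B) (J.filter fun ω => X a ω = v) =
      projCard X B (J.filter fun ω => X a ω = v) := by
  unfold projCard
  rw [← Finset.card_image_of_injOn (s := Finset.image (fun ω (b : ↥(insert a B)) => X b ω) _)
    (f := Finset.restrict₂ (π := β) (Finset.subset_insert a B)), Finset.image_image]
  · rfl
  · intro p hp q hq hpq
    obtain ⟨ω, hω, rfl⟩ := Finset.mem_image.1 (Finset.mem_coe.1 hp)
    obtain ⟨ω', hω', rfl⟩ := Finset.mem_image.1 (Finset.mem_coe.1 hq)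
    funext ⟨b, hb⟩
    rcases Finset.mem_insert.1 hb with rfl | hb
    · exact (Finset.mem_filter.1 hω).2.trans (Finset.mem_filter.1 hω').2.symm
    · exact congrFun hpq ⟨b, hb⟩

open Classical in
/-- The fractional edge cover bound of Atserias, Grohe and Marx. -/
theorem projCard_le_prod_rpow {ι : Type*} [Fintype ι] (S : ι → Finset V) (γ : ι → ℝ)
    (hγ : ∀ i, 0 ≤ γ i) (B : Finset V) (hB : ∀ a ∈ B, 1 ≤ ∑ i with a ∈ S i, γ i)
    {J : Finset Ω} (hJ : J.Nonempty) :
    (projCard X B J : ℝ) ≤ ∏ i, (projCard X (S i) J : ℝ) ^ γ i := by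
  induction B using Finset.induction_on generalizing J with
  | empty =>
    calc (projCard X ∅ J : ℝ) ≤ 1 := mod_cast projCard_empty_le_one X J
      _ = ∏ _i : ι, (1 : ℝ) := Finset.prod_const_one.symm
      _ ≤ _ := Finset.prod_le_prod (fun _ _ => zero_le_one) fun i _ =>
        Real.one_le_rpow (mod_cast projCard_pos X (S i) hJ) (hγ i)
  | insert a B ha ih =>
    have hfib : ∀ v ∈ J.image (X a), (J.filter fun ω => X a ω = v).Nonempty := by
      intro v hv
      obtain ⟨ω, hω, rfl⟩ := Finset.mem_image.1 hv
      exact ⟨ω, Finset.mem_filter.2 ⟨hω, rfl⟩⟩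
    rw [projCard_eq_sum_fiber X (Finset.mem_insert_self a B), Nat.cast_sum]
    -- Hölder over the values of `a`: for edges containing `a` the fibre counts sum to the full
    -- count, and these edges have total weight at least `1`; for the others, each fibre count is at
    -- most the full count.
    refine (Finset.sum_le_sum fun v hv => ?_).trans
      (sum_prod_rpow_le_prod_rpow (J.image (X a)) {i | a ∈ S i} γ hγ
        (hB a (Finset.mem_insert_self a B))
        (fun i v => (projCard X (S i) (J.filter fun ω => X a ω = v) : ℝ))
        (fun i => (projCard X (S i) J : ℝ)) (fun _ _ _ => Nat.cast_nonneg _)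
        (fun i => mod_cast projCard_pos X (S i) hJ)
        (fun i v _ => mod_cast projCard_mono X (S i) (Finset.filter_subset _ J))
        fun i hi => ?_)
    · rw [projCard_insert_fiber]
      exact ih (fun b hb => hB b (Finset.mem_insert_of_mem hb)) (hfib v hv)
    · rw [projCard_eq_sum_fiber X (Finset.mem_filter.1 hi).2 J, Nat.cast_sum]

end ProjCard

/-! ### Linear programming duality via separation of convex sets. -/

namespace MultiHypergraph

variable {V : Type u} {E : Type v} [DecidableEq V] [Fintype E]

/-- Linear programming duality for fractional edge covers: there is a fractional vertex packing
whose weight is that of a minimal fractional edge cover. -/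
theorem IsMinFractionalEdgeCover.exists_packing {H : MultiHypergraph V E} {γ : E → ℝ}
    (hγ : H.IsMinFractionalEdgeCover γ) (hne : H.nodes.Nonempty) :
    ∃ y : V → ℝ, (∀ a, 0 ≤ y a) ∧ (∀ e, ∑ a ∈ H.edge e, y a ≤ 1) ∧
      ∑ a ∈ H.nodes, y a = ∑ e, γ e := by
  classical
  obtain ⟨⟨hγ0, hγ1⟩, hmin⟩ := hγ
  set ρ := ∑ e, γ e
  have hρ : 0 < ρ := by
    obtain ⟨a, ha⟩ := hne
    exact zero_lt_one.trans_le ((hγ1 a ha).trans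
      (Finset.sum_le_sum_of_subset_of_nonneg (Finset.filter_subset _ _) fun e _ _ => hγ0 e))
  -- `A g` records how much `g` covers each node. `C` holds the coverages affordable with weight
  -- `ρ`, `U` those exceeding `1` everywhere. A common point, divided by its least coverage, would
  -- be a cover lighter than `ρ`.
  let U : Set (H.nodes → ℝ) := {x | ∀ a, 1 < x a}
  let A : (E → ℝ) → H.nodes → ℝ := fun g a => ∑ e with (a : V) ∈ H.edge e, g e
  let C : Set (H.nodes → ℝ) := {x | ∃ g : E → ℝ, (∀ e, 0 ≤ g e) ∧ ∑ e, g e ≤ ρ ∧ A g = x}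
  have hUo : IsOpen U := by
    have : U = ⋂ a, {x : H.nodes → ℝ | 1 < x a} := by ext; simp [U]
    rw [this]
    exact isOpen_iInter_of_finite fun a => isOpen_lt continuous_const (continuous_apply a)
  have hUc : Convex ℝ U := by
    intro x hx y hy p q hp hq hpq a
    have h1 := hx a
    have h2 := hy a
    simp only [Pi.add_apply, Pi.smul_apply, smul_eq_mul]
    rcases hp.eq_or_lt with rfl | hp
    · rw [zero_add] at hpq
      simpa [hpq] using h2
    · nlinarith [mul_lt_mul_of_pos_left h1 hp, mul_le_mul_of_nonneg_left h2.le hq]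
  have hCc : Convex ℝ C := by
    rintro _ ⟨g, hg0, hg1, rfl⟩ _ ⟨g', hg0', hg1', rfl⟩ p q hp hq hpq
    refine ⟨p • g + q • g', fun e => add_nonneg (mul_nonneg hp (hg0 e)) (mul_nonneg hq (hg0' e)),
      ?_, ?_⟩
    · simp only [Pi.add_apply, Pi.smul_apply, smul_eq_mul, Finset.sum_add_distrib,
        ← Finset.mul_sum]
      calc p * ∑ e, g e + q * ∑ e, g' e ≤ p * ρ + q * ρ := by gcongr
        _ = ρ := by rw [← add_mul, hpq, one_mul]
    · funext a
      simp only [A, Pi.add_apply, Pi.smul_apply, smul_eq_mul, Finset.sum_add_distrib,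
        ← Finset.mul_sum]
  have hdisj : Disjoint U C := by
    rw [Set.disjoint_left]
    rintro _ hx ⟨g, hg0, hg1, rfl⟩
    have := hne.to_subtype
    obtain ⟨a₀, ha₀⟩ := Finite.exists_min (A g)
    have hm : 1 < A g a₀ := hx a₀
    have hm0 : 0 < A g a₀ := zero_lt_one.trans hm
    have h := hmin (fun e => g e / A g a₀) ⟨fun e => div_nonneg (hg0 e) hm0.le, fun v hv => by
      rw [← Finset.sum_div, one_le_div hm0]
      exact ha₀ ⟨v, hv⟩⟩
    rw [← Finset.sum_div, le_div_iff₀ hm0] at h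
    nlinarith
  obtain ⟨f, s, hfU, hfC⟩ := geometric_hahn_banach_open hUc hUo hCc hdisj
  have hf : ∀ x, f x = ∑ a, x a * f (Pi.single a 1) := fun x => by
    have := LinearMap.pi_apply_eq_sum_univ f.toLinearMap x
    simp only [smul_eq_mul] at this
    refine this.trans (Finset.sum_congr rfl fun a _ => ?_)
    have hsingle : (fun j => if a = j then (1 : ℝ) else 0) = Pi.single a 1 := by
      funext b
      simp [Pi.single_apply, eq_comm]
    rw [hsingle]
    rfl
  -- With this sign, `w` pairs to more than `-s` on `U` and to at most `-s` on `C`; rescaled, it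
  -- becomes the packing.
  set w : H.nodes → ℝ := fun a => -f (Pi.single a 1) with hw
  have hf' : ∀ x, f x = -∑ a, x a * w a := fun x => by
    rw [hf, ← Finset.sum_neg_distrib]
    exact Finset.sum_congr rfl fun a _ => by simp [hw]
  set W := ∑ a, w a with hW
  have hconst : ∀ c : ℝ, 1 < c → -s < c * W := fun c hc => by
    have := hfU (fun _ => c) fun _ => hc
    rw [hf', ← Finset.mul_sum] at this
    linarith
  have hs : s ≤ 0 := by
    have := hfC 0 ⟨0, fun _ => le_rfl, by simpa using hρ.le, by funext a; simp [A]⟩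
    simpa using this
  have hW0 : 0 < W := by linarith [hconst 2 one_lt_two]
  have hw0 : ∀ a, 0 ≤ w a := by
    intro a
    by_contra! ha
    -- A point of `U` pushed this far in direction `a` has `f` equal to `-s`, which is at least `s`.
    set t := (2 * W - s) / -w a with ht
    have ht0 : 0 ≤ t := div_nonneg (by linarith) (by linarith)
    have h := hfU (fun b => 2 + Pi.single (M := fun _ => ℝ) a t b) fun b => by
      have : 0 ≤ Pi.single (M := fun _ => ℝ) a t b := by
        rw [Pi.single_apply]; split_ifs <;> simp [ht0]
      linarith
    rw [hf'] at h
    simp only [add_mul, Finset.sum_add_distrib, ← Finset.mul_sum, Pi.single_apply, ite_mul,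
      zero_mul, Finset.sum_ite_eq', Finset.mem_univ, if_true] at h
    have h2 : t * w a = -(2 * W - s) := by
      rw [ht]; field_simp [ha.ne]
    rw [h2] at h
    linarith
  have hsW : -s ≤ W := by
    by_contra! h
    have := hconst (-s / W) ((one_lt_div hW0).2 h)
    rw [div_mul_cancel₀ _ hW0.ne'] at this
    exact this.false
  refine ⟨fun a => if ha : a ∈ H.nodes then ρ / W * w ⟨a, ha⟩ else 0, fun a => ?_, fun e => ?_, ?_⟩
  · dsimp only
    split_ifs
    · exact mul_nonneg (div_nonneg hρ.le hW0.le) (hw0 _)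
    · exact le_rfl
  -- Putting the whole budget `ρ` on the edge `e` gives a point of `C`, so `ρ` times the `w`-weight
  -- of `e` is at most `-s ≤ W`.
  · have h := hfC (A (Pi.single e ρ)) ⟨Pi.single e ρ, fun e' => by
      rw [Pi.single_apply]; split_ifs <;> simp [hρ.le], by simp, rfl⟩
    rw [hf'] at h
    have h1 : ∑ a, A (Pi.single e ρ) a * w a =
        ρ * ∑ a ∈ Finset.univ.filter (fun a : H.nodes => (a : V) ∈ H.edge e), w a := by
      rw [Finset.mul_sum, Finset.sum_filter]
      refine Finset.sum_congr rfl fun a _ => ?_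
      simp only [A, Finset.sum_filter]
      split_ifs with hae
      · rw [Finset.sum_eq_single e] <;> simp +contextual [hae]
      · rw [Finset.sum_eq_zero]
        · simp
        · intro e' _
          split_ifs with h'
          · rw [Pi.single_apply, if_neg]
            rintro rfl
            exact hae h'
          · rfl
    rw [h1] at h
    have h2 : ∑ a ∈ H.edge e, (if ha : a ∈ H.nodes then ρ / W * w ⟨a, ha⟩ else 0) =
        ρ / W * ∑ a ∈ Finset.univ.filter (fun a : H.nodes => (a : V) ∈ H.edge e), w a := by
      rw [Finset.mul_sum, Finset.sum_filter, ← Finset.inter_eq_right.2 (H.edge_subset e),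
        ← Finset.filter_mem_eq_inter, Finset.sum_filter, ← Finset.sum_coe_sort H.nodes]
      refine Finset.sum_congr rfl fun a _ => ?_
      simp [a.2]
    rw [h2, div_mul_eq_mul_div, div_le_one hW0]
    linarith
  · rw [← Finset.sum_coe_sort H.nodes]
    simp only [Finset.coe_mem, dif_pos, Subtype.coe_eta]
    rw [← Finset.mul_sum, ← hW, div_mul_cancel₀ _ hW0.ne']

end MultiHypergraph

/-! ### Upper bound on covers. -/

section Upper

variable {Att : Type u} {dom : Att → Type v}

/-- `projCard` needs coordinates for all attributes; `none` fills those outside `S` and is never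
read, as `B ⊆ S`. -/
theorem Relation.card_proj_eq_projCard [DecidableEq Att] {B S : Finset Att} (h : B ⊆ S)
    (R : Relation dom S) :
    (Relation.proj h R).card =
      projCard (β := fun a => Option (dom a))
        (fun a (t : Tuple dom S) => if ha : a ∈ S then some (t ⟨a, ha⟩) else none) B R := by
  classical
  have hinj : Function.Injective fun (p : Tuple dom B) (a : B) => some (p a) :=
    fun p q hpq => funext fun a => Option.some_injective _ (congrFun hpq a)
  have hfun : (fun (t : Tuple dom S) (a : B) =>
      if ha : (a : Att) ∈ S then some (t ⟨a, ha⟩) else none) =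
      (fun (p : Tuple dom B) (a : B) => some (p a)) ∘ Finset.restrict₂ (π := dom) h :=
    funext fun t => funext fun a => dif_pos (h a.2)
  unfold projCard Relation.proj
  rw [hfun]
  refine (Finset.card_image_of_injective _ hinj).symm.trans ?_
  rw [Finset.image_image]
  congr!

variable [DecidableEq Att] {Q : NaturalJoinQuery Att} {N : Type w}

namespace NaturalJoinQuery

theorem proj_schema_result_subset (Q : NaturalJoinQuery Att) (D : Database dom Q)
    (i : Fin Q.n) : Relation.proj (Q.schema_subset_att i) (Q.result D) ⊆ D i := by
  classical
  intro p hp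
  obtain ⟨t, ht, rfl⟩ := Finset.mem_image.1 hp
  exact (Q.mem_result D t).1 ht i

/-- The projection of a query result onto `B` is bounded by means of a fractional edge cover
of `B`. -/
theorem card_proj_result_le (Q : NaturalJoinQuery Att) (D : Database dom Q) {B : Finset Att}
    (hB : B ⊆ Q.att) {γ : Fin Q.n → ℝ} (hγ : (Q.hypergraph.restrict B).IsFractionalEdgeCover γ)
    (hne : (Q.result D).Nonempty) :
    ((Relation.proj hB (Q.result D)).card : ℝ) ≤ (D.size : ℝ) ^ ∑ i, γ i := by
  rw [Relation.card_proj_eq_projCard]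
  refine (projCard_le_prod_rpow _ Q.schema γ hγ.1 B (fun a ha => ?_) hne).trans ?_
  · refine (hγ.2 a (Finset.mem_inter.2 ⟨hB ha, ha⟩)).trans_eq (Finset.sum_congr ?_ fun _ _ => rfl)
    ext i
    simp [MultiHypergraph.restrict, hypergraph, ha]
  · rw [Real.rpow_sum_of_nonneg (Nat.cast_nonneg _) fun i _ => hγ.1 i]
    refine Finset.prod_le_prod (fun i _ => Real.rpow_nonneg (Nat.cast_nonneg _) _) fun i _ => ?_
    refine Real.rpow_le_rpow (Nat.cast_nonneg _) (Nat.cast_le.2 ?_) (hγ.1 i)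
    rw [← Relation.card_proj_eq_projCard (Q.schema_subset_att i)]
    exact (Finset.card_le_card (Q.proj_schema_result_subset D i)).trans
      (Finset.single_le_sum (f := fun i => (D i).card) (fun _ _ => Nat.zero_le _)
        (Finset.mem_univ i))

end NaturalJoinQuery

namespace FractionalHypertreeDecomposition

variable [Fintype N] {T : FractionalHypertreeDecomposition Q N}

theorem weight_le_fhtw (T : FractionalHypertreeDecomposition Q N) (t : N) :
    ∑ i, T.γ t i ≤ T.fhtw :=
  Finset.le_sup' (fun t => ∑ i, T.γ t i) (Finset.mem_univ t)

theorem IsCover.card_le_sum_card_proj {D : Database dom Q} {K : Relation dom Q.att}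
    (hK : T.IsCover D K) :
    K.card ≤ ∑ t, (Relation.proj (T.bag_subset t) (Q.result D)).card := by
  classical
  have h : ∀ t, ∃ L ⊆ K, L.card = (Relation.proj (T.bag_subset t) K).card ∧
      Relation.proj (T.bag_subset t) L = Relation.proj (T.bag_subset t) K := fun t => by
    obtain ⟨L, hLK, hinj, hL⟩ := Finset.exists_subset_injOn_image_eq_of_surjOn
      (f := Finset.restrict₂ (π := dom) (T.bag_subset t)) (K : Set (Tuple dom Q.att))
      (Relation.proj (T.bag_subset t) K) (by simp [Relation.proj, Set.surjOn_image])
    exact ⟨L, Finset.coe_subset.1 hLK, by rw [← hL, Finset.card_image_of_injOn hinj], hL⟩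
  choose L hLK hcard hproj using h
  have hsub : Finset.univ.biUnion L ⊆ K := Finset.biUnion_subset.2 fun t _ => hLK t
  have heq : Finset.univ.biUnion L = K := by
    by_contra hne
    refine hK.2 _ (hsub.ssubset_of_ne hne) fun t => ?_
    rw [← hK.1 t]
    refine (Finset.image_subset_image hsub).antisymm ?_
    rw [← Relation.proj, ← hproj t]
    exact Finset.image_subset_image (Finset.subset_biUnion_of_mem L (Finset.mem_univ t))
  calc K.card = (Finset.univ.biUnion L).card := by rw [heq]
    _ ≤ ∑ t, (L t).card := Finset.card_biUnion_le
    _ = _ := Finset.sum_congr rfl fun t _ => by rw [hcard t, hK.1 t]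

theorem IsCover.card_le {D : Database dom Q} {K : Relation dom Q.att}
    (hK : T.IsCover D K) : (K.card : ℝ) ≤ Fintype.card N * (D.size : ℝ) ^ T.fhtw := by
  refine (Nat.cast_le.2 hK.card_le_sum_card_proj).trans ?_
  rw [Nat.cast_sum, ← Finset.card_univ, ← nsmul_eq_mul]
  refine Finset.sum_le_card_nsmul _ _ _ fun t _ => ?_
  rcases (Q.result D).eq_empty_or_nonempty with h0 | hne
  · simp only [h0, Relation.proj, Finset.image_empty, Finset.card_empty, Nat.cast_zero]
    positivity
  refine (Q.card_proj_result_le D (T.bag_subset t) (T.γ_min t).1 hne).trans ?_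
  -- Monotonicity in the exponent needs base at least `1`. An empty database with a nonempty result
  -- forces a query without relations, and both sides use `0 ^ 0`.
  rcases Nat.eq_zero_or_pos D.size with hD | hD
  · have : IsEmpty (Fin Q.n) := by
      refine ⟨fun i => ?_⟩
      obtain ⟨s, hs⟩ := hne
      have := Finset.card_pos.2 ⟨_, (Q.mem_result D s).1 hs i⟩
      exact this.ne' (Finset.sum_eq_zero_iff.1 hD i (Finset.mem_univ i))
    have hf : T.fhtw = 0 := by simp [fhtw]
    rw [hf, Finset.univ_eq_empty, Finset.sum_empty]
  · exact Real.rpow_le_rpow_of_exponent_le (mod_cast hD) (T.weight_le_fhtw t)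

end FractionalHypertreeDecomposition

end Upper

/-! ### Lower bound by product databases. -/

section Lower

variable {Att : Type u} {dom : Att → Type v} [DecidableEq Att]

namespace NaturalJoinQuery

/-- The database whose relations are the full products of the sets `W a` of values. -/
def productDatabase (Q : NaturalJoinQuery Att) (W : ∀ a, Finset (dom a)) : Database dom Q :=
  fun i => Fintype.piFinset fun a : Q.schema i => W a

theorem card_productDatabase (Q : NaturalJoinQuery Att) (W : ∀ a, Finset (dom a))
    (i : Fin Q.n) : (Q.productDatabase W i).card = ∏ a ∈ Q.schema i, (W a).card := by
  rw [productDatabase, Fintype.card_piFinset]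
  exact Finset.prod_coe_sort (Q.schema i) fun a => (W a).card

theorem mem_result_productDatabase (Q : NaturalJoinQuery Att) (W : ∀ a, Finset (dom a))
    (t : Tuple dom Q.att) : t ∈ Q.result (Q.productDatabase W) ↔
      ∀ a : Q.att, t a ∈ W a := by
  rw [mem_result]
  simp only [productDatabase, Fintype.mem_piFinset]
  refine ⟨fun h a => ?_, fun h i a => h ⟨a, Q.schema_subset_att i a.2⟩⟩
  obtain ⟨i, -, hi⟩ := Finset.mem_biUnion.1 a.2
  exact h i ⟨a, hi⟩

theorem card_proj_result_productDatabase (Q : NaturalJoinQuery Att) (W : ∀ a, Finset (dom a))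
    (hW : ∀ a ∈ Q.att, (W a).Nonempty) {B : Finset Att} (hB : B ⊆ Q.att) :
    (Relation.proj hB (Q.result (Q.productDatabase W))).card = ∏ a ∈ B, (W a).card := by
  classical
  have : Relation.proj hB (Q.result (Q.productDatabase W)) =
      Fintype.piFinset fun a : B => W a := by
    ext p
    simp only [Relation.proj, Finset.mem_image, mem_result_productDatabase,
      Fintype.mem_piFinset]
    constructor
    · rintro ⟨t, ht, rfl⟩ a
      exact ht ⟨a, hB a.2⟩
    · intro hp
      -- Attributes outside `B` take arbitrary values, available because every `W a` is nonempty.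
      refine ⟨fun a => if ha : (a : Att) ∈ B then p ⟨a, ha⟩ else (hW a a.2).choose,
        fun a => ?_, ?_⟩
      · dsimp only
        split_ifs with ha
        · exact hp ⟨a, ha⟩
        · exact (hW a a.2).choose_spec
      · funext a
        exact dif_pos a.2
  rw [this, Fintype.card_piFinset]
  exact Finset.prod_coe_sort B fun a => (W a).card

end NaturalJoinQuery

namespace FractionalHypertreeDecomposition

variable {Q : NaturalJoinQuery Att} {N : Type w}

theorem IsCover.card_proj_le {T : FractionalHypertreeDecomposition Q N} {D : Database dom Q}
    {K : Relation dom Q.att} (hK : T.IsCover D K) (t : N) :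
    (Relation.proj (T.bag_subset t) (Q.result D)).card ≤ K.card := by
  classical
  rw [← hK.1 t]
  exact Finset.card_image_le

variable [Fintype N]

theorem one_le_fhtw (T : FractionalHypertreeDecomposition Q N) (hQ : Q.att.Nonempty) :
    1 ≤ T.fhtw := by
  obtain ⟨a, ha⟩ := hQ
  obtain ⟨t, ht⟩ := (T.connectivity a ha).nonempty
  refine (((T.γ_min t).1.2 a (Finset.mem_inter.2 ⟨ha, ht⟩)).trans ?_).trans (T.weight_le_fhtw t)
  exact Finset.sum_le_sum_of_subset_of_nonneg (Finset.filter_subset _ _)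
    fun i _ _ => (T.γ_min t).1.1 i

/-- A fractional vertex packing of a bag of maximal weight. -/
theorem exists_packing (T : FractionalHypertreeDecomposition Q N) (hQ : Q.att.Nonempty) :
    ∃ (t : N) (y : Att → ℝ), (∀ a, 0 ≤ y a) ∧ (∀ i, ∑ a ∈ Q.schema i ∩ T.bag t, y a ≤ 1) ∧
      ∑ a ∈ T.bag t, y a = T.fhtw := by
  obtain ⟨t, -, ht⟩ := Finset.exists_mem_eq_sup' T.univ_nonempty fun t => ∑ i, T.γ t i
  have hnodes : (Q.hypergraph.restrict (T.bag t)).nodes = T.bag t :=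
    Finset.inter_eq_right.2 (T.bag_subset t)
  have hne : (T.bag t).Nonempty := by
    rw [Finset.nonempty_iff_ne_empty]
    intro h0
    have h := (T.γ_min t).2 0 ⟨fun _ => le_rfl, fun v hv => by
      rw [hnodes, h0] at hv
      exact absurd hv (Finset.notMem_empty v)⟩
    have h1 : 1 ≤ ∑ i, T.γ t i := (T.one_le_fhtw hQ).trans_eq ht
    simp only [Pi.zero_apply, Finset.sum_const_zero] at h
    linarith
  obtain ⟨y, hy0, hy1, hy⟩ := (T.γ_min t).exists_packing (by rwa [hnodes])
  exact ⟨t, y, hy0, hy1, by rw [hnodes] at hy; exact hy.trans ht.symm⟩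

theorem exists_database_fhtw_le (T : FractionalHypertreeDecomposition Q N)
    (hQ : Q.att.Nonempty) :
    ∃ c : ℝ, 0 < c ∧ ∀ dom : Att → Type v, (∀ a ∈ Q.att, Infinite (dom a)) →
      ∀ M : ℕ, ∃ D : Database dom Q, M ≤ D.size ∧
        ∀ K : Relation dom Q.att,
          T.IsCover D K → c * (D.size : ℝ) ^ T.fhtw ≤ (K.card : ℝ) := by
  obtain ⟨t, y, hy0, hy1, hy⟩ := T.exists_packing hQ
  have hρ : 1 ≤ T.fhtw := T.one_le_fhtw hQ
  have hn : 0 < (Q.n : ℝ) := by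
    obtain ⟨a, ha⟩ := hQ
    obtain ⟨i, -⟩ := Finset.mem_biUnion.1 ha
    exact Nat.cast_pos.2 i.pos
  -- The factor `n ^ fhtw` pays for `|D| ≤ n * m`, the power of `2` for rounding `m ^ y a` down at
  -- each attribute of the bag.
  refine ⟨((Q.n : ℝ) ^ T.fhtw * 2 ^ (T.bag t).card)⁻¹, by positivity, fun dom hdom M => ?_⟩
  -- One attribute with positive packing weight has unboundedly many values as `m` grows, which
  -- forces `|D| ≥ M`.
  obtain ⟨a₀, ha₀, hya₀⟩ : ∃ a ∈ T.bag t, 0 < y a := by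
    by_contra! h
    linarith [Finset.sum_nonpos h]
  obtain ⟨i₀, -, hi₀⟩ := Finset.mem_biUnion.1 (T.bag_subset t ha₀)
  obtain ⟨m, hm1, hmM⟩ : ∃ m : ℕ, 1 ≤ m ∧ (M : ℝ) ≤ (m : ℝ) ^ y a₀ :=
    ((Filter.eventually_ge_atTop 1).and (((tendsto_rpow_atTop hya₀).comp
      tendsto_natCast_atTop_atTop).eventually_ge_atTop (M : ℝ))).exists
  have hm0 : (0 : ℝ) < m := mod_cast hm1
  have hpow : ∀ a, 1 ≤ (m : ℝ) ^ y a := fun a => Real.one_le_rpow (mod_cast hm1) (hy0 a)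
  -- A single value outside the bag keeps those attributes from enlarging any relation.
  let k : Att → ℕ := fun a => if a ∈ T.bag t then ⌊(m : ℝ) ^ y a⌋₊ else 1
  have hk1 : ∀ a, 1 ≤ k a := fun a => by
    simp only [k]
    split_ifs
    · exact Nat.le_floor (by simpa using hpow a)
    · exact le_rfl
  have hW : ∀ a, ∃ s : Finset (dom a), a ∈ Q.att → s.card = k a := fun a => by
    by_cases ha : a ∈ Q.att
    · have := hdom a ha
      obtain ⟨s, hs⟩ := Infinite.exists_subset_card_eq (dom a) (k a)
      exact ⟨s, fun _ => hs⟩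
    · exact ⟨∅, fun h => absurd h ha⟩
  choose W hW using hW
  have hcard : ∀ i, (Q.productDatabase W i).card = ∏ a ∈ Q.schema i, k a := fun i => by
    rw [Q.card_productDatabase]
    exact Finset.prod_congr rfl fun a ha => hW a (Q.schema_subset_att i ha)
  have hle : ∀ i, ((Q.productDatabase W i).card : ℝ) ≤ m := fun i => by
    rw [hcard, Nat.cast_prod]
    calc ∏ a ∈ Q.schema i, (k a : ℝ)
        ≤ ∏ a ∈ Q.schema i, (if a ∈ T.bag t then (m : ℝ) ^ y a else 1) := by
          refine Finset.prod_le_prod (fun _ _ => Nat.cast_nonneg _) fun a _ => ?_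
          simp only [k]
          split_ifs
          · exact Nat.floor_le (zero_le_one.trans (hpow a))
          · simp
      _ = (m : ℝ) ^ ∑ a ∈ Q.schema i ∩ T.bag t, y a := by
          rw [← Finset.prod_filter, Finset.filter_mem_eq_inter,
            Real.rpow_sum_of_nonneg hm0.le fun a _ => hy0 a]
      _ ≤ (m : ℝ) ^ (1 : ℝ) := Real.rpow_le_rpow_of_exponent_le (mod_cast hm1) (hy1 i)
      _ = m := Real.rpow_one _
  have hsize : ((Q.productDatabase W).size : ℝ) ≤ Q.n * m := by
    rw [Database.size, Nat.cast_sum]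
    refine (Finset.sum_le_card_nsmul _ _ _ fun i _ => hle i).trans_eq ?_
    rw [Finset.card_univ, Fintype.card_fin, nsmul_eq_mul]
  refine ⟨Q.productDatabase W, ?_, fun K hK => ?_⟩
  · calc M ≤ k a₀ := by
          simp only [k, if_pos ha₀]
          exact Nat.le_floor hmM
      _ ≤ ∏ a ∈ Q.schema i₀, k a :=
          Finset.single_le_prod' (fun a _ => hk1 a) hi₀
      _ = (Q.productDatabase W i₀).card := (hcard i₀).symm
      _ ≤ _ := Finset.single_le_sum (f := fun i => (Q.productDatabase W i).card)
          (fun _ _ => Nat.zero_le _) (Finset.mem_univ i₀)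
  · calc ((Q.n : ℝ) ^ T.fhtw * 2 ^ (T.bag t).card)⁻¹ *
          ((Q.productDatabase W).size : ℝ) ^ T.fhtw
        ≤ ((Q.n : ℝ) ^ T.fhtw * 2 ^ (T.bag t).card)⁻¹ * (Q.n * m) ^ T.fhtw := by
          gcongr
      _ = (m : ℝ) ^ T.fhtw / 2 ^ (T.bag t).card := by
          rw [Real.mul_rpow hn.le hm0.le]
          have : (Q.n : ℝ) ^ T.fhtw ≠ 0 := (Real.rpow_pos_of_pos hn _).ne'
          field_simp
      _ = ∏ a ∈ T.bag t, (m : ℝ) ^ y a / 2 := by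
          rw [Finset.prod_div_distrib, Finset.prod_const, ← hy,
            Real.rpow_sum_of_nonneg hm0.le fun a _ => hy0 a]
      _ ≤ ∏ a ∈ T.bag t, ((W a).card : ℝ) := by
          refine Finset.prod_le_prod (fun a _ => by positivity) fun a ha => ?_
          rw [hW a (T.bag_subset t ha)]
          simp only [k, if_pos ha]
          exact (Nat.div_two_lt_floor (hpow a)).le
      _ = ((Relation.proj (T.bag_subset t) (Q.result (Q.productDatabase W))).card : ℝ) := by
          rw [Q.card_proj_result_productDatabase W
            (fun a ha => Finset.card_pos.1 ((hk1 a).trans_eq (hW a ha).symm)), Nat.cast_prod]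
      _ ≤ K.card := Nat.cast_le.2 (hK.card_proj_le t)

end FractionalHypertreeDecomposition

end Lower

theorem mainTheorem1 {Att : Type u} [DecidableEq Att] (Q : NaturalJoinQuery Att)
    {N : Type w} [Fintype N] (T : FractionalHypertreeDecomposition Q N) :
    (∃ C : ℝ, 0 < C ∧
      ∀ (dom : Att → Type v) (D : Database dom Q) (K : Relation dom Q.att),
        T.IsCover D K → (K.card : ℝ) ≤ C * (D.size : ℝ) ^ T.fhtw) ∧
    (Q.att.Nonempty →
      ∃ c : ℝ, 0 < c ∧
        ∀ dom : Att → Type v, (∀ a ∈ Q.att, Infinite (dom a)) →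
          ∀ M : ℕ, ∃ D : Database dom Q, M ≤ D.size ∧
            ∀ K : Relation dom Q.att,
              T.IsCover D K → c * (D.size : ℝ) ^ T.fhtw ≤ (K.card : ℝ)) :=
  ⟨⟨Fintype.card N, Nat.cast_pos.2 (Finset.card_pos.2 T.univ_nonempty),
    fun _ _ _ hK => hK.card_le⟩, T.exists_database_fhtw_le⟩
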